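/- For $k\ge 1$ let $J_k$ be the $k\times k$ nilpotent Jordan block (entries $1$ in positions $(i,i+1)$, $1\le i<k$, and $0$ elsewhere). Every nilpotent real $n\times n$ matrix is conjugate over $\mathbb R$ to a direct sum $J_{k_1}\oplus\cdots\oplus J_{k_r}$ whose block sizes are unique up to order. For a nilpotent real matrix $N$ with these block sizes let $h(N)=\max_i k_i$ be the maximum block size, let $\beta(N)$ be the number of $i$ with $k_i\ge 2$, and let $\beta^{\mathrm{top}}(N)$ be the number of $i$ with $k_i=h(N)$; $N$ has a zero Jordan block if some $k_i=1$. These notions depend only on the conjugacy class $\mathcal C$ of $N$, and we write $h(\mathcal C)$, $\beta^{\mathrm{top}}(\mathcal C)$ accordingly. Let $\|\cdot\|_{\max}$ denote the maximum absolute value of the entries of a matrix. **Theorem.** Let $N$ be a nilpotent real $n\times n$ matrix and let $\mathcal C$ be a conjugacy class (under $GL_n(\mathbb R)$) of nilpotent real $n\times n$ matrices such that 1. the Jordan form of a matrix in $\mathcal C$ has a zero Jordan block; 2. $h(\mathcal C)\ge h(N)$; 3. $\beta^{\mathrm{top}}(\mathcal C)\ge \beta(N)$. Then $\mathcal C$ is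 locally connected at $N$: for every $\epsilon>0$ there exists $\delta>0$ such that any two matrices $A,B\in\mathcal C$ with $\|A-N\|_{\max}<\delta$ and $\|B-N\|_{\max}<\delta$ are connected by a (continuous) path lying in $\{M\in\mathcal C:\|M-N\|_{\max}<\epsilon\}$. -/

import Mathlib

namespace NilpotentClass

/-- Real `n × n` matrices. -/
abbrev Mat (n : ℕ) : Type := Matrix (Fin n) (Fin n) ℝ

/-- The nilpotent Jordan block `J_k`: ones in the positions `(i, i + 1)`, zeros elsewhere. -/
def jordanBlock (k : ℕ) : Mat k :=
  Matrix.of fun i j => if (j : ℕ) = (i : ℕ) + 1 then 1 else 0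

/-- The nilpotent matrix in Jordan form `J_{k₁} ⊕ ⋯ ⊕ J_{k_r}`, where `c = (k₁, …, k_r)` is a
composition of `n` (a list of positive integers with sum `n`). -/
def jordanMatrix {n : ℕ} (c : Composition n) : Mat n :=
  Matrix.reindex c.blocksFinEquiv c.blocksFinEquiv
    (Matrix.blockDiagonal' fun i : Fin c.length => jordanBlock (c.blocksFun i))

/-- The block sizes of a Jordan form of the matrices in `C`: a composition `c` of `n` such that the
matrix in Jordan form with block sizes `c` lies in `C`. For a class of nilpotent matrices there is
such a `c`, and it is unique up to the order of the blocks. -/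
noncomputable def jordanSizes {n : ℕ} (C : ConjClasses (Mat n)) : Composition n :=
  Classical.epsilon fun c => jordanMatrix c ∈ C.carrier

/-- The Jordan form of a matrix in `C` has a zero Jordan block, that is, a block `J_1`. -/
def HasZeroBlock {n : ℕ} (C : ConjClasses (Mat n)) : Prop :=
  1 ∈ (jordanSizes C).blocks

/-- `h`: the maximum size of a Jordan block. -/
noncomputable def height {n : ℕ} (C : ConjClasses (Mat n)) : ℕ :=
  (jordanSizes C).blocks.foldr max 0

/-- `β`: the number of Jordan blocks of size at least `2`. -/
noncomputable def beta {n : ℕ} (C : ConjClasses (Mat n)) : ℕ :=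
  (jordanSizes C).blocks.countP fun k => 2 ≤ k

/-- `β^top`: the number of Jordan blocks of maximum size. -/
noncomputable def betaTop {n : ℕ} (C : ConjClasses (Mat n)) : ℕ :=
  (jordanSizes C).blocks.count (height C)

/-- The set of matrices `B` with `‖B - A‖_max < ε`; all its uses have `0 < ε`. -/
def maxBall {n : ℕ} (A : Mat n) (ε : ℝ) : Set (Mat n) :=
  {B | ∀ i j, |B i j - A i j| < ε}

/-- `C` is locally connected at `N`. -/
def LocallyConnectedAt {n : ℕ} (C : ConjClasses (Mat n)) (N : Mat n) : Prop :=
  ∀ ε : ℝ, 0 < ε → ∃ δ : ℝ, 0 < δ ∧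
    ∀ A ∈ C.carrier ∩ maxBall N δ, ∀ B ∈ C.carrier ∩ maxBall N δ,
      JoinedIn (C.carrier ∩ maxBall N ε) A B

end NilpotentClass

open Filter Topology Module

namespace NilpotentClass

/-! In a Jordan basis of $N$, consider the slice `chainSlice`: the matrices that agree with $N$ on
every basis vector except the last vectors of the chains, those killed by $N$. Three facts about
this slice give the theorem.

A matrix $A\in\mathcal C$ near $N$ can be moved into the slice. Let $G$ be the matrix whose columns
are the chains under $A$ of vectors close to the generators of the chains of $N$. Then $G$ is near
$1$ and $G^{-1}AG$ lies in the slice. Since $\beta^{\mathrm{top}}(\mathcal C)\ge\beta(N)$, each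
chain of $N$ of length at least $2$ can be assigned its own longest chain of $\mathcal C$. After a
generic small perturbation, the chosen vectors then generate longest chains of $A$
(`exists_nhds_joinedIn_genericSlice`).

Two such matrices $A,B$ of the slice are joined inside it (`joinedIn_chainSlice`). Generators of the
longest chains can be prescribed (`exists_basis_of_top`), so some $F$ with $FA=BF$ fixes all chains
of $N$ of length at least $2$. The zero block of $\mathcal C$ allows a change of sign that makes
$\det F>0$. Then $F$ is joined to $1$ through matrices of positive determinant that fix these
chains, and conjugating $A$ along this path stays in the slice.

This path may go far from $N$. However, the slice carries a contraction towards $N$, a conjugation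
by a diagonal matrix combined with a scaling. Nilpotent classes are invariant under nonzero scaling,
so it preserves $\mathcal C$ and brings the whole path close to $N$
(`joinedIn_entryBall_of_chainSlice`). -/

/-- The family `x` consists of Jordan chains for `T`: the chain with index `i` is
`x ⟨i, k i - 1⟩ ↦ ⋯ ↦ x ⟨i, 1⟩ ↦ x ⟨i, 0⟩ ↦ 0`. -/
structure IsJordanChain {V I : Type*} [AddCommGroup V] [Module ℝ V] {k : I → ℕ}
    (T : End ℝ V) (x : (Σ i, Fin (k i)) → V) : Prop where
  apply_zero : ∀ i (h : 0 < k i), T (x ⟨i, ⟨0, h⟩⟩) = 0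
  apply_succ : ∀ i a (h : a + 1 < k i), T (x ⟨i, ⟨a + 1, h⟩⟩) = x ⟨i, ⟨a, by omega⟩⟩

/-! ### Jordan chains and the choice of longest chains -/

section Chain

variable {V I : Type*} [AddCommGroup V] [Module ℝ V] {k : I → ℕ} {T : End ℝ V}

namespace IsJordanChain

variable {x : (Σ i, Fin (k i)) → V}

theorem pow_apply_add (hx : IsJordanChain T x) (i : I) (a j : ℕ) (h : a + j < k i) :
    (T ^ j) (x ⟨i, ⟨a + j, h⟩⟩) = x ⟨i, ⟨a, by omega⟩⟩ := by
  induction j with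
  | zero => rfl
  | succ j ih =>
    rw [pow_succ, End.mul_apply]
    have := hx.apply_succ i (a + j) h
    rw [show x ⟨i, ⟨a + (j + 1), h⟩⟩ = x ⟨i, ⟨a + j + 1, h⟩⟩ from rfl, this]
    exact ih _

theorem pow_apply_of_lt (hx : IsJordanChain T x) (i : I) (a : Fin (k i)) (j : ℕ)
    (h : (a : ℕ) < j) : (T ^ j) (x ⟨i, a⟩) = 0 := by
  obtain ⟨a, ha⟩ := a
  obtain ⟨l, rfl⟩ : ∃ l, j = l + 1 + a := ⟨j - a - 1, by simp at h; omega⟩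
  have := hx.pow_apply_add i 0 a (by omega)
  simp only [Nat.zero_add] at this
  rw [pow_add, End.mul_apply, this, pow_succ, End.mul_apply, hx.apply_zero, map_zero]

/-- Jordan chains whose end vectors are linearly independent are linearly independent. -/
theorem linearIndependent [Fintype I] (hx : IsJordanChain T x) (hk : ∀ i, 0 < k i)
    (h0 : LinearIndependent ℝ fun i => x ⟨i, ⟨0, hk i⟩⟩) : LinearIndependent ℝ x := by
  classical
  rw [Fintype.linearIndependent_iff] at h0 ⊢
  intro g hg
  obtain ⟨K, hK⟩ : ∃ K, ∀ i, k i ≤ K := ⟨∑ i, k i, fun i =>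
    Finset.single_le_sum (f := k) (fun _ _ => Nat.zero_le _) (Finset.mem_univ i)⟩
  -- Downward induction on the position `a`: applying `T ^ a` kills all lower positions, the higher
  -- coefficients already vanish, and only end vectors remain.
  have key : ∀ n a, K ≤ a + n → ∀ i (h : a < k i), g ⟨i, ⟨a, h⟩⟩ = 0 := by
    intro n
    induction n with
    | zero => intro a ha i h; have := hK i; omega
    | succ n ih =>
      intro a ha i h
      have h1 := congrArg (T ^ a) hg
      rw [map_zero, map_sum, Fintype.sum_sigma] at h1
      have h2 := h0 (fun i => if h : a < k i then g ⟨i, ⟨a, h⟩⟩ else 0) (by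
        rw [← h1]
        refine Finset.sum_congr rfl fun i _ => ?_
        by_cases hi : a < k i
        · rw [Finset.sum_eq_single (⟨a, hi⟩ : Fin (k i)), dif_pos hi, map_smul]
          · have := hx.pow_apply_add i 0 a (by omega)
            simp only [Nat.zero_add] at this
            rw [this]
          · intro b _ hb
            rcases lt_or_gt_of_ne (fun h => hb (Fin.ext h) : (b : ℕ) ≠ a) with hb | hb
            · rw [map_smul, hx.pow_apply_of_lt i b a hb, smul_zero]
            · rw [ih b (by omega) i b.2, zero_smul, map_zero]
          · simp
        · rw [dif_neg hi, zero_smul, Finset.sum_eq_zero]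
          intro b _
          rw [map_smul, hx.pow_apply_of_lt i b a (by omega), smul_zero]) i
      simpa [h] using h2
  rintro ⟨i, a, h⟩
  exact key K a (by omega) i h

end IsJordanChain

theorem IsJordanChain.pow_eq_zero {b : Basis (Σ i, Fin (k i)) ℝ V} (hb : IsJordanChain T b)
    {h : ℕ} (hk : ∀ i, k i ≤ h) : T ^ h = 0 := by
  refine b.ext fun ⟨i, a⟩ => ?_
  rw [hb.pow_apply_of_lt i a h (a.2.trans_le (hk i)), LinearMap.zero_apply]

/-- The image of `T ^ (h - 1)` is spanned by the end vectors of the chains of length exactly `h`, so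
it has no component along a shorter chain. -/
theorem IsJordanChain.coord_pow_eq_zero {b : Basis (Σ i, Fin (k i)) ℝ V}
    (hb : IsJordanChain T b) {h : ℕ} (hk : ∀ i, k i ≤ h) (j : I) (hj : k j ≠ h) (a : Fin (k j))
    (v : V) : b.coord ⟨j, a⟩ ((T ^ (h - 1)) v) = 0 := by
  suffices H : b.coord ⟨j, a⟩ ∘ₗ T ^ (h - 1) = 0 from LinearMap.congr_fun H v
  refine b.ext fun ⟨i, c, hc⟩ => ?_
  have := hk i
  rw [LinearMap.comp_apply, LinearMap.zero_apply]
  by_cases hc' : c < h - 1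
  · rw [hb.pow_apply_of_lt i _ _ hc', map_zero]
  · obtain rfl : c = 0 + (h - 1) := by omega
    rw [hb.pow_apply_add i 0 (h - 1) hc, Basis.coord_apply, Basis.repr_self,
      Finsupp.single_eq_of_ne]
    intro h'
    have h'' : j = i := congrArg Sigma.fst h'
    exact hj (by subst h''; omega)

/-- The generators of the Jordan chains of maximal length can be chosen freely, as long as the
end vectors of the chains generated by them are linearly independent. -/
theorem IsJordanChain.exists_basis_of_top [Fintype I] {b : Basis (Σ i, Fin (k i)) ℝ V}
    (hb : IsJordanChain T b) (hk0 : ∀ i, 0 < k i) {h : ℕ} (hk : ∀ i, k i ≤ h)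
    (v : {i // k i = h} → V) (hv : LinearIndependent ℝ fun i => (T ^ (h - 1)) (v i)) :
    ∃ b' : Basis (Σ i, Fin (k i)) ℝ V, IsJordanChain T b' ∧
      ∀ i : {i // k i = h}, b' ⟨i, ⟨k i - 1, Nat.sub_lt (hk0 i) one_pos⟩⟩ = v i := by
  classical
  let x : (Σ i, Fin (k i)) → V := fun s =>
    if hs : k s.1 = h then (T ^ (k s.1 - 1 - s.2)) (v ⟨s.1, hs⟩) else b s
  have hx : IsJordanChain T x := by
    constructor
    · intro i hi
      by_cases hs : k i = h
      · simp only [x, dif_pos hs]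
        rw [← End.mul_apply, ← pow_succ']
        have : k i - 1 - 0 + 1 = h := by omega
        rw [this, hb.pow_eq_zero hk, LinearMap.zero_apply]
      · simp only [x, dif_neg hs]
        exact hb.apply_zero i hi
    · intro i a ha
      by_cases hs : k i = h
      · simp only [x, dif_pos hs]
        rw [← End.mul_apply, ← pow_succ']
        have : k i - 1 - (a + 1) + 1 = k i - 1 - a := by omega
        rw [this]
      · simp only [x, dif_neg hs]
        exact hb.apply_succ i a ha
  have hli : LinearIndependent ℝ x := by
    refine hx.linearIndependent hk0 ?_
    rw [Fintype.linearIndependent_iff]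
    intro g hg
    -- The new end vectors are values of `T ^ (h - 1)`, hence invisible to the old coordinates along
    -- shorter chains. This separates the two kinds of chains.
    have hnon : ∀ j, k j ≠ h → g j = 0 := by
      intro j hj
      have h1 := congrArg (b.coord ⟨j, ⟨0, hk0 j⟩⟩) hg
      rw [map_sum, map_zero, Finset.sum_eq_single j] at h1
      · simpa [x, hj] using h1
      · intro i _ hij
        by_cases hs : k i = h
        · simp only [x, dif_pos hs, map_smul]
          have : k i - 1 - 0 = h - 1 := by omega
          rw [this, hb.coord_pow_eq_zero hk j hj, smul_zero]
        · simp only [x, dif_neg hs, map_smul]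
          rw [Basis.coord_apply, Basis.repr_self, Finsupp.single_eq_of_ne, smul_zero]
          exact fun h' => hij (congrArg Sigma.fst h').symm
      · simp
    have htop := Fintype.linearIndependent_iff.1 hv (fun i => g i) (by
      rw [← hg, ← Fintype.sum_subtype_add_sum_subtype (fun i => k i = h)]
      rw [Finset.sum_eq_zero (s := (Finset.univ : Finset {i // ¬ k i = h}))
        fun i _ => by rw [hnon i i.2, zero_smul], add_zero]
      refine Finset.sum_congr rfl fun i _ => ?_
      have : k i - 1 - 0 = h - 1 := by have := i.2; omega
      simp only [x, dif_pos i.2, this])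
    intro i
    by_cases hs : k i = h
    · exact htop ⟨i, hs⟩
    · exact hnon i hs
  have : FiniteDimensional ℝ V := b.finiteDimensional_of_finite
  let b' := basisOfLinearIndependentOfCardEqFinrank' x hli (finrank_eq_card_basis b).symm
  have hb' : ⇑b' = x := coe_basisOfLinearIndependentOfCardEqFinrank' _ _ _
  refine ⟨b', by rwa [hb'], fun i => ?_⟩
  rw [hb']
  simp [x, i.2]

theorem eventually_det_add_smul_one_ne_zero {ι : Type*} [Fintype ι] [DecidableEq ι]
    (M : Matrix ι ι ℝ) : ∀ᶠ s : ℝ in 𝓝[≠] 0, (M + s • 1).det ≠ 0 := by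
  have hfin : {s : ℝ | (-M).charpoly.IsRoot s}.Finite :=
    Polynomial.finite_setOfPred_isRoot (-M).charpoly_monic.ne_zero
  have := (hfin.subset Set.sdiff_subset : ({s : ℝ | (-M).charpoly.IsRoot s} \ {0}).Finite).isClosed.isOpen_compl.mem_nhds
      (show (0 : ℝ) ∈ _ by simp)
  filter_upwards [nhdsWithin_le_nhds this, self_mem_nhdsWithin] with s hs hs0 hdet
  refine hs ⟨?_, hs0⟩
  simp only [Set.mem_ofPred_eq, Polynomial.IsRoot.def, Matrix.eval_charpoly]
  rw [← hdet, sub_neg_eq_add, add_comm, Matrix.smul_one_eq_diagonal]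
  rfl

/-- Perturbing in the direction of the old generators adds `s • 1` to the matrix of end coordinates.
Its determinant is a nonzero polynomial in `s`, so generic small perturbations give independent end
vectors. -/
theorem IsJordanChain.eventually_linearIndependent [Finite I] {b : Basis (Σ i, Fin (k i)) ℝ V}
    (hb : IsJordanChain T b) {h : ℕ} (hh : 0 < h) (w : {i // k i = h} → V) :
    ∃ g : {i // k i = h} → V, ∀ᶠ s : ℝ in 𝓝[≠] 0,
      LinearIndependent ℝ fun i => (T ^ (h - 1)) (w i + s • g i) := by
  classical
  have := Fintype.ofFinite I
  refine ⟨fun i => b ⟨i, ⟨h - 1, by have := i.2; omega⟩⟩, ?_⟩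
  let M : Matrix {i // k i = h} {i // k i = h} ℝ :=
    Matrix.of fun i j => b.coord ⟨i, ⟨0, by have := i.2; omega⟩⟩ ((T ^ (h - 1)) (w j))
  filter_upwards [eventually_det_add_smul_one_ne_zero M] with s hs
  rw [Fintype.linearIndependent_iff]
  intro g hg
  have hg0 : g = 0 := by
    refine Matrix.eq_zero_of_mulVec_eq_zero hs (funext fun i => ?_)
    have h1 := congrArg (b.coord ⟨i, ⟨0, by have := i.2; omega⟩⟩) hg
    rw [map_sum, map_zero] at h1
    rw [Pi.zero_apply, ← h1, Matrix.mulVec, dotProduct]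
    refine Finset.sum_congr rfl fun j _ => ?_
    have h2 := hb.pow_apply_add j 0 (h - 1) (by have := j.2; omega)
    simp only [Nat.zero_add] at h2
    rw [map_smul, map_add, map_smul, h2, map_add, map_smul, Basis.coord_apply, Basis.coord_apply,
      Basis.repr_self]
    simp only [M, Matrix.add_apply, Matrix.of_apply, Matrix.smul_apply, smul_eq_mul,
      Basis.coord_apply]
    rw [mul_comm]
    congr 3
    by_cases hij : i = j
    · subst hij; simp
    · rw [Matrix.one_apply_ne hij, Finsupp.single_eq_of_ne]
      exact fun h' => hij (Subtype.ext (congrArg Sigma.fst h'))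
  intro i
  rw [hg0, Pi.zero_apply]

end Chain

/-! ### Connectedness of groups of matrices with positive determinant -/

section PosDet

variable {ι : Type*} [Fintype ι] [DecidableEq ι]

/-- The real matrices with positive determinant. -/
def posDet (ι : Type*) [Fintype ι] [DecidableEq ι] : Set (Matrix ι ι ℝ) := {M | 0 < M.det}

theorem joinedIn_posDet_mul {A B C D : Matrix ι ι ℝ} (h₁ : JoinedIn (posDet ι) A B)
    (h₂ : JoinedIn (posDet ι) C D) : JoinedIn (posDet ι) (A * C) (B * D) := by
  obtain ⟨γ, hγ⟩ := h₁
  obtain ⟨η, hη⟩ := h₂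
  refine ⟨⟨⟨fun t => γ t * η t, by fun_prop⟩, by simp, by simp⟩, fun t => ?_⟩
  show 0 < (γ t * η t).det
  rw [Matrix.det_mul]
  exact mul_pos (hγ t) (hη t)

theorem joinedIn_posDet_transvection {i j : ι} (hij : i ≠ j) (c : ℝ) :
    JoinedIn (posDet ι) 1 (Matrix.transvection i j c) := by
  refine ⟨⟨⟨fun t => Matrix.transvection i j ((t : ℝ) * c), ?_⟩, by simp, by simp⟩, fun t => ?_⟩
  · have : (fun t : unitInterval => Matrix.transvection i j ((t : ℝ) * c)) =
        fun t : unitInterval => 1 + (t : ℝ) • Matrix.single i j c := by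
      ext t; simp [Matrix.transvection, Matrix.smul_single]
    rw [this]
    fun_prop
  · show 0 < (Matrix.transvection i j ((t : ℝ) * c)).det
    rw [Matrix.det_transvection_of_ne _ _ hij]
    exact one_pos

theorem joinedIn_posDet_transvection_prod (L : List (Matrix.TransvectionStruct ι ℝ)) :
    JoinedIn (posDet ι) 1 (L.map Matrix.TransvectionStruct.toMatrix).prod := by
  induction L with
  | nil => exact JoinedIn.refl (by simp [posDet])
  | cons t L ih =>
    rw [List.map_cons, List.prod_cons, ← mul_one (1 : Matrix ι ι ℝ)]
    exact joinedIn_posDet_mul (joinedIn_posDet_transvection t.hij t.c) ih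

/-- Changing two signs in a diagonal matrix does not leave the component of the identity. -/
theorem joinedIn_posDet_two_signs {i j : ι} (hij : i ≠ j) :
    JoinedIn (posDet ι) 1
      (Matrix.diagonal fun l => if l = i ∨ l = j then (-1 : ℝ) else 1) := by
  set X : Matrix ι ι ℝ := Matrix.single i j 1 with hX
  set Y : Matrix ι ι ℝ := Matrix.single j i 1 with hY
  have hXX : X * X = 0 := by simp [hX, hij.symm]
  have hYY : Y * Y = 0 := by simp [hY, hij]
  have hXYX : X * Y * X = X := by simp [hX, hY]
  have hYXY : Y * X * Y = Y := by simp [hX, hY]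
  have h1 : Matrix.transvection i j (-1 : ℝ) = 1 - X := by
    rw [Matrix.transvection, hX, sub_eq_add_neg, ← Matrix.single_neg]
  have h2 : Matrix.transvection j i (1 : ℝ) = 1 + Y := rfl
  have hw : (1 - X) * (1 + Y) * (1 - X) = 1 + Y - X - X * Y - Y * X := by
    have : (1 - X) * (1 + Y) * (1 - X) =
        1 + Y - X - X - X * Y - Y * X + X * X + X * Y * X := by noncomm_ring
    rw [this, hXX, hXYX]
    abel
  -- The product of three transvections is a quarter turn in the plane of `i` and `j`; its square is
  -- `-1` on that plane.
  have hd : (Matrix.diagonal fun l => if l = i ∨ l = j then (-1 : ℝ) else 1) =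
      ((1 - X) * (1 + Y) * (1 - X)) * ((1 - X) * (1 + Y) * (1 - X)) := by
    have h3 : ((1 - X) * (1 + Y) * (1 - X)) * ((1 - X) * (1 + Y) * (1 - X)) =
        1 - 2 • (X * Y) - 2 • (Y * X) := by
      rw [hw]
      have : (1 + Y - X - X * Y - Y * X) * (1 + Y - X - X * Y - Y * X) =
          1 + 2 • Y - 2 • X - 3 • (X * Y) - 3 • (Y * X) + Y * Y + X * X
          - Y * X * Y - Y * Y * X + X * X * Y + X * Y * X
          - X * (Y * Y) + X * Y * X + X * Y * X * Y + X * (Y * Y) * X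
          - Y * X * Y + Y * (X * X) + Y * (X * X) * Y + Y * X * Y * X := by noncomm_ring
      rw [this, hXX, hYY, hXYX, hYXY]
      simp only [mul_zero, zero_mul, add_zero, sub_zero]
      abel
    rw [h3]
    ext a c
    simp only [hX, hY, Matrix.single_mul_single_same, Matrix.sub_apply, Matrix.smul_apply,
      Matrix.diagonal_apply, Matrix.one_apply, Matrix.single_apply]
    by_cases hac : a = c
    · subst hac
      by_cases hi : a = i
      · subst hi; simp [hij.symm]; norm_num
      · by_cases hj : a = j
        · subst hj; simp [hij]; norm_num
        · simp [hi, hj, Ne.symm hi, Ne.symm hj]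
    · have h4 : ¬ (i = a ∧ i = c) := fun h => hac (h.1.symm.trans h.2)
      have h5 : ¬ (j = a ∧ j = c) := fun h => hac (h.1.symm.trans h.2)
      simp [hac, h4, h5]
  rw [hd, ← h1, ← h2]
  have hA := joinedIn_posDet_transvection hij (-1 : ℝ)
  have hB := joinedIn_posDet_transvection hij.symm (1 : ℝ)
  have h := joinedIn_posDet_mul (joinedIn_posDet_mul hA hB) hA
  simpa using joinedIn_posDet_mul h h

theorem joinedIn_posDet_diagonal (d : ι → ℝ) (hd : 0 < ∏ i, d i) :
    JoinedIn (posDet ι) 1 (Matrix.diagonal d) := by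
  induction hm : (Finset.univ.filter fun i => d i < 0).card using Nat.strong_induction_on
    generalizing d with
  | _ m ih =>
    have hne : ∀ i, d i ≠ 0 := fun i h =>
      hd.ne' (Finset.prod_eq_zero (Finset.mem_univ i) h)
    by_cases hneg : ∃ i, d i < 0
    · obtain ⟨i, hi⟩ := hneg
      obtain ⟨j, hji, hj⟩ : ∃ j, j ≠ i ∧ d j < 0 := by
        by_contra! hcon
        rw [← Finset.mul_prod_erase _ _ (Finset.mem_univ i)] at hd
        refine absurd hd (not_lt.2 (mul_nonpos_of_nonpos_of_nonneg hi.le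
          (Finset.prod_nonneg fun l hl => hcon l (Finset.ne_of_mem_erase hl))))
      set s : ι → ℝ := fun l => if l = i ∨ l = j then (-1 : ℝ) else 1 with hs
      have hss : ∀ l, s l * s l = 1 := fun l => by simp only [hs]; split_ifs <;> norm_num
      have hsp : ∏ l, s l = 1 := by
        have h1 : ∏ l, s l = (∏ l, if l = i then (-1 : ℝ) else 1) *
            ∏ l, if l = j then (-1 : ℝ) else 1 := by
          rw [← Finset.prod_mul_distrib]
          refine Finset.prod_congr rfl fun l _ => ?_
          by_cases h1 : l = i
          · subst h1; simp [hs, hji.symm]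
          · simp [hs, h1]
        rw [h1]; simp
      have h1 := ih _ ?_ (fun l => d l * s l) (by rwa [Finset.prod_mul_distrib, hsp, mul_one]) rfl
      · have h2 := joinedIn_posDet_mul h1 (joinedIn_posDet_two_signs hji.symm)
        rw [Matrix.diagonal_mul_diagonal, mul_one] at h2
        have h3 : (fun l => d l * s l * s l) = d := funext fun l => by
          rw [mul_assoc, hss, mul_one]
        rwa [← h3]
      · rw [← hm]
        refine Finset.card_lt_card (Finset.ssubset_iff_of_subset ?_ |>.2 ⟨i, ?_⟩)
        · intro l
          simp only [Finset.mem_filter, Finset.mem_univ, true_and, hs]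
          split_ifs with h
          · rcases h with rfl | rfl <;> intro <;> assumption
          · simp
        · simp [hs, hi, hi.le]
    · push Not at hneg
      have hpos : ∀ i, 0 < d i := fun i => lt_of_le_of_ne (hneg i) (hne i).symm
      refine ⟨⟨⟨fun t => Matrix.diagonal fun i => (1 - (t : ℝ)) + t * d i, ?_⟩, ?_, ?_⟩, ?_⟩
      · exact Continuous.matrix_diagonal (by fun_prop)
      · simp
      · simp
      · intro t
        show 0 < (Matrix.diagonal fun i => (1 - (t : ℝ)) + t * d i).det
        rw [Matrix.det_diagonal]
        refine Finset.prod_pos fun i _ => ?_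
        rcases t.2.2.lt_or_eq with h | h
        · exact add_pos_of_pos_of_nonneg (sub_pos.2 h) (mul_nonneg t.2.1 (hpos i).le)
        · rw [h]; simpa using hpos i

/-- The matrices with positive determinant form a path connected set. -/
theorem joinedIn_posDet (M : Matrix ι ι ℝ) (hM : 0 < M.det) : JoinedIn (posDet ι) 1 M := by
  obtain ⟨L, L', D, h⟩ := Matrix.Pivot.exists_list_transvec_mul_diagonal_mul_list_transvec M
  have hD : 0 < ∏ i, D i := by
    rw [h, Matrix.det_mul, Matrix.det_mul, Matrix.TransvectionStruct.det_toMatrix_prod,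
      Matrix.TransvectionStruct.det_toMatrix_prod, Matrix.det_diagonal] at hM
    simpa using hM
  have := joinedIn_posDet_mul (joinedIn_posDet_mul (joinedIn_posDet_transvection_prod L)
    (joinedIn_posDet_diagonal D hD)) (joinedIn_posDet_transvection_prod L')
  rw [h]
  simpa using this

/-- The matrices with positive determinant that fix given standard basis vectors form a path
connected set. -/
theorem joinedIn_posDet_fixing (p : ι → Prop) (M : Matrix ι ι ℝ) (hM : 0 < M.det)
    (hp : ∀ x, p x → M.col x = Pi.single x 1) :
    JoinedIn {G : Matrix ι ι ℝ | 0 < G.det ∧ ∀ x, p x → G.col x = Pi.single x 1} 1 M := by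
  classical
  let e : {x // p x} ⊕ {x // ¬ p x} ≃ ι := Equiv.sumCompl p
  let f : Matrix {x // p x} {x // ¬ p x} ℝ → Matrix {x // ¬ p x} {x // ¬ p x} ℝ → Matrix ι ι ℝ :=
    fun X Y => Matrix.reindex e e (Matrix.fromBlocks 1 X 0 Y)
  have hf : ∀ X Y, (f X Y).det = Y.det := fun X Y => by
    simp [f]
  have hfc : ∀ X Y x, p x → (f X Y).col x = Pi.single x 1 := by
    intro X Y x hx
    ext y
    obtain ⟨y, rfl⟩ := e.surjective y
    obtain ⟨x, rfl⟩ : ∃ x', x = e (Sum.inl x') := ⟨⟨x, hx⟩, rfl⟩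
    simp only [f, Matrix.col_apply, Matrix.reindex_apply, Matrix.submatrix_apply,
      Equiv.symm_apply_apply, Pi.single_apply, e.injective.eq_iff]
    cases y <;> simp [Matrix.one_apply]
  -- Fixing the vectors in `p` means the block form `[1 X; 0 Y]`. The block `X` can be scaled from
  -- `0`, so only a path for `Y` is needed.
  have hMf : M = f (M.submatrix (e ∘ Sum.inl) (e ∘ Sum.inr))
      (M.submatrix (e ∘ Sum.inr) (e ∘ Sum.inr)) := by
    ext y x
    by_cases hx : p x
    · have h1 := congrFun (hp x hx) y
      have h2 := congrFun (hfc (M.submatrix (e ∘ Sum.inl) (e ∘ Sum.inr))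
        (M.submatrix (e ∘ Sum.inr) (e ∘ Sum.inr)) x hx) y
      exact h1.trans h2.symm
    · obtain ⟨y, rfl⟩ := e.surjective y
      obtain ⟨x, rfl⟩ : ∃ x', x = e (Sum.inr x') := ⟨⟨x, hx⟩, rfl⟩
      cases y <;> simp [f]
  have h1 : f 0 1 = 1 := by simp [f]
  set X := M.submatrix (e ∘ Sum.inl) (e ∘ Sum.inr)
  set Y := M.submatrix (e ∘ Sum.inr) (e ∘ Sum.inr)
  obtain ⟨γ, hγ⟩ := joinedIn_posDet Y (by rwa [hMf, hf] at hM)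
  rw [hMf, ← h1]
  refine ⟨⟨⟨fun t => f ((t : ℝ) • X) (γ t), ?_⟩, by simp, by simp⟩, fun t => ⟨?_, hfc _ _⟩⟩
  · have : Continuous fun t : unitInterval => Matrix.fromBlocks
        (1 : Matrix {x // p x} {x // p x} ℝ) ((t : ℝ) • X)
        (0 : Matrix {x // ¬ p x} {x // p x} ℝ) (γ t) :=
      Continuous.matrix_fromBlocks continuous_const (by fun_prop) (by fun_prop) (by fun_prop)
    exact this.matrix_submatrix _ _
  · show 0 < (f ((t : ℝ) • X) (γ t)).det
    rw [hf]
    exact hγ t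

end PosDet

/-! ### Entrywise balls as neighbourhoods -/

section EntryBall

variable {ι : Type*}

/-- The matrices whose entries differ by less than `ε` from those of `A`. -/
def entryBall (A : Matrix ι ι ℝ) (ε : ℝ) : Set (Matrix ι ι ℝ) := {B | ∀ i j, |B i j - A i j| < ε}

theorem entryBall_mem_nhds [Finite ι] (A : Matrix ι ι ℝ) {ε : ℝ} (hε : 0 < ε) : entryBall A ε ∈ 𝓝 A := by
  have : ∀ i j, ∀ᶠ B : Matrix ι ι ℝ in 𝓝 A, |B i j - A i j| < ε := fun i j => by
    have hc : Continuous fun B : Matrix ι ι ℝ => |B i j - A i j| :=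
      ((continuous_id.matrix_elem i j).sub continuous_const).abs
    exact hc.continuousAt.eventually_lt continuousAt_const (by simpa using hε)
  exact eventually_all.2 fun i => eventually_all.2 fun j => this i j

theorem exists_entryBall_subset [Fintype ι] {A : Matrix ι ι ℝ} {U : Set (Matrix ι ι ℝ)} (hU : U ∈ 𝓝 A) :
    ∃ ε > 0, entryBall A ε ⊆ U := by
  obtain ⟨ε, hε, h⟩ := (Metric.mem_nhds_iff (α := ι → ι → ℝ) (x := A) (s := U)).1 hU
  refine ⟨ε, hε, fun B hB => h ?_⟩
  exact Metric.mem_ball.2 <| (dist_pi_lt_iff hε).2 fun i => (dist_pi_lt_iff hε).2 fun j => hB i j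

theorem lineMap_mem_entryBall {A B : Matrix ι ι ℝ} {ε : ℝ} (hB : B ∈ entryBall A ε) {t : ℝ}
    (ht0 : 0 ≤ t) (ht1 : t ≤ 1) : A + t • (B - A) ∈ entryBall A ε := by
  intro i j
  have : (A + t • (B - A)) i j - A i j = t * (B i j - A i j) := by simp
  rw [this, abs_mul, abs_of_nonneg ht0]
  exact (mul_le_of_le_one_left (abs_nonneg _) ht1).trans_lt (hB i j)

end EntryBall

/-! ### Classes of matrices with given Jordan chains -/

section Matrices

variable {ι : Type*} [Fintype ι] [DecidableEq ι]

theorem continuousAt_matrix_inv {M : Matrix ι ι ℝ} (hM : M.det ≠ 0) :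
    ContinuousAt (fun G : Matrix ι ι ℝ => G⁻¹) M := by
  have : (fun G : Matrix ι ι ℝ => G⁻¹) = fun G => (G.det)⁻¹ • G.adjugate := by
    ext1 G
    rw [Matrix.inv_def, Ring.inverse_eq_inv']
  rw [this]
  have h1 : Continuous fun G : Matrix ι ι ℝ => G.det := continuous_id.matrix_det
  have h2 : Continuous fun G : Matrix ι ι ℝ => G.adjugate := continuous_id.matrix_adjugate
  exact (h1.continuousAt.inv₀ hM).smul h2.continuousAt

/-- The matrices with a basis of Jordan chains of lengths `m`. -/
def jordanClass (ι : Type*) [Fintype ι] [DecidableEq ι] {I : Type*} (m : I → ℕ) :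
    Set (Matrix ι ι ℝ) :=
  {A | ∃ b : Basis (Σ i, Fin (m i)) ℝ (ι → ℝ), IsJordanChain (Matrix.toLin' A) b}

variable {I : Type*} {m : I → ℕ}

/-- If $B=tFAF^{-1}$, the vectors $t^{-a}Fb_{i,a}$ are Jordan chains for $B$: rescaling along each
chain absorbs the factor $t$. -/
theorem mem_jordanClass_of_mul_eq {A B F : Matrix ι ι ℝ} (hA : A ∈ jordanClass ι m)
    (hF : F.det ≠ 0) {t : ℝ} (ht : t ≠ 0) (h : B * F = t • (F * A)) : B ∈ jordanClass ι m := by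
  obtain ⟨b, hb⟩ := hA
  have hF' : IsUnit F.det := isUnit_iff_ne_zero.2 hF
  let f : (ι → ℝ) ≃ₗ[ℝ] (ι → ℝ) :=
    LinearEquiv.ofIsUnitDet (v := Pi.basisFun ℝ ι) (v' := Pi.basisFun ℝ ι) (f := Matrix.toLin' F)
      (by simpa [← LinearMap.toMatrix_eq_toMatrix'] using hF')
  have hf : ∀ v, f v = F.mulVec v := fun v => Matrix.toLin'_apply F v
  have hw : ∀ s : Σ i, Fin (m i), IsUnit ((t⁻¹) ^ (s.2 : ℕ)) := fun s =>
    isUnit_iff_ne_zero.2 (pow_ne_zero _ (inv_ne_zero ht))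
  have hBF : ∀ v, B.mulVec (F.mulVec v) = t • F.mulVec (A.mulVec v) := fun v => by
    rw [Matrix.mulVec_mulVec, h, Matrix.smul_mulVec, Matrix.mulVec_mulVec]
  refine ⟨(b.map f).isUnitSMul hw, ?_, ?_⟩
  · intro i hi
    have := hb.apply_zero i hi
    rw [Matrix.toLin'_apply] at this
    rw [Basis.isUnitSMul_apply, Basis.map_apply, map_smul, Matrix.toLin'_apply, hf, hBF, this]
    simp
  · intro i a hi
    have := hb.apply_succ i a hi
    rw [Matrix.toLin'_apply] at this
    rw [Basis.isUnitSMul_apply, Basis.isUnitSMul_apply, Basis.map_apply, Basis.map_apply, map_smul,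
      Matrix.toLin'_apply, hf, hBF, this, hf, smul_smul, pow_succ, mul_assoc, inv_mul_cancel₀ ht,
      mul_one]

theorem IsJordanChain.comp_eq {V W : Type*} [AddCommGroup V] [Module ℝ V] [AddCommGroup W]
    [Module ℝ W] {T : End ℝ V} {S : End ℝ W} {b : Basis (Σ i, Fin (m i)) ℝ V}
    (hb : IsJordanChain T b) {y : (Σ i, Fin (m i)) → W} (hy : IsJordanChain S y) (f : V →ₗ[ℝ] W)
    (hf : ∀ s, f (b s) = y s) : f ∘ₗ T = S ∘ₗ f := by
  refine b.ext fun ⟨i, a, ha⟩ => ?_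
  rw [LinearMap.comp_apply, LinearMap.comp_apply, hf]
  rcases a with _ | a
  · rw [hb.apply_zero, hy.apply_zero, map_zero]
  · rw [hb.apply_succ, hy.apply_succ, hf]

/-- Two nilpotent matrices with the same Jordan form, together with generators of their longest
Jordan chains, are conjugate by a matrix of positive determinant if there is a zero Jordan
block. -/
theorem exists_det_pos_mul_eq_mul [Fintype I] {A B : Matrix ι ι ℝ} (hA : A ∈ jordanClass ι m)
    (hB : B ∈ jordanClass ι m) (hm0 : ∀ i, 0 < m i) {h : ℕ} (hm : ∀ i, m i ≤ h) (hh : 2 ≤ h)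
    {z : I} (hz : m z = 1) {v w : {i // m i = h} → ι → ℝ}
    (hv : LinearIndependent ℝ fun i => (Matrix.toLin' A ^ (h - 1)) (v i))
    (hw : LinearIndependent ℝ fun i => (Matrix.toLin' B ^ (h - 1)) (w i)) :
    ∃ F : Matrix ι ι ℝ, 0 < F.det ∧ F * A = B * F ∧ ∀ i, F.mulVec (v i) = w i := by
  classical
  obtain ⟨b₁, hb₁⟩ := hA
  obtain ⟨b₂, hb₂⟩ := hB
  obtain ⟨b₁, hb₁, hv⟩ := hb₁.exists_basis_of_top hm0 hm v hv
  obtain ⟨b₂, hb₂, hw⟩ := hb₂.exists_basis_of_top hm0 hm w hw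
  suffices H : ∃ f : (ι → ℝ) →ₗ[ℝ] (ι → ℝ), 0 < LinearMap.det f ∧
      f ∘ₗ Matrix.toLin' A = Matrix.toLin' B ∘ₗ f ∧ ∀ i, f (v i) = w i by
    obtain ⟨f, hf, hfc, hfv⟩ := H
    refine ⟨LinearMap.toMatrix' f, by rwa [LinearMap.det_toMatrix'], ?_, fun i => ?_⟩
    · apply Matrix.toLin'.injective
      rw [Matrix.toLin'_mul, Matrix.toLin'_mul, Matrix.toLin'_toMatrix', hfc]
    · rw [← Matrix.toLin'_apply, Matrix.toLin'_toMatrix', hfv]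
  let f₀ : (ι → ℝ) ≃ₗ[ℝ] (ι → ℝ) := b₁.equiv b₂ (Equiv.refl _)
  have hf₀ : ∀ s, f₀ (b₁ s) = b₂ s := fun s => by simp [f₀]
  have hdet : LinearMap.det (f₀ : (ι → ℝ) →ₗ[ℝ] (ι → ℝ)) ≠ 0 := f₀.isUnit_det'.ne_zero
  rcases lt_or_gt_of_ne hdet with hneg | hpos
  -- Reversing the chain `z` commutes with the action and has determinant `-1` because `z` has
  -- length one. Since `h ≥ 2`, it leaves the prescribed generators alone.
  · let d : (Σ i, Fin (m i)) → ℝ := fun s => if s.1 = z then -1 else 1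
    let g : (ι → ℝ) →ₗ[ℝ] (ι → ℝ) := Matrix.toLin b₂ b₂ (Matrix.diagonal d)
    have hg : ∀ s, g (b₂ s) = d s • b₂ s := fun s => by
      rw [Matrix.toLin_self, Finset.sum_eq_single s]
      · simp
      · intro t _ hts
        rw [Matrix.diagonal_apply_ne _ hts, zero_smul]
      · simp
    have hgdet : LinearMap.det g = -1 := by
      rw [LinearMap.det_toLin, Matrix.det_diagonal, Fintype.prod_sigma, Finset.prod_eq_single z]
      · simp [d, hz]
      · intro i _ hi
        simp [d, hi]
      · simp
    refine ⟨g ∘ₗ f₀, ?_, ?_, fun i => ?_⟩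
    · rw [LinearMap.det_comp, hgdet]
      linarith
    · refine hb₁.comp_eq (y := fun s => d s • b₂ s) ⟨fun i hi => ?_, fun i a hi => ?_⟩ _ fun s => ?_
      · rw [map_smul, hb₂.apply_zero, smul_zero]
      · rw [map_smul, hb₂.apply_succ]
      · rw [LinearMap.comp_apply, LinearEquiv.coe_coe, hf₀, hg]
    · have hi : (i : I) ≠ z := fun h' => by have := i.2; rw [h', hz] at this; omega
      rw [LinearMap.comp_apply, LinearEquiv.coe_coe, ← hv, hf₀, hg, ← hw]
      simp [d, hi]
  · refine ⟨f₀, hpos, hb₁.comp_eq hb₂ _ hf₀, fun i => ?_⟩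
    rw [← hv, ← hw]
    exact hf₀ _

end Matrices

/-! ### The slice through the Jordan form and its contraction -/

section Slice

variable {I I' : Type*} [Fintype I] [DecidableEq I] {k : I → ℕ} {m : I' → ℕ}

/-- The matrices that act on the standard basis vectors like the nilpotent matrix in Jordan form
with block sizes `k`, except possibly on the end vectors of the Jordan chains. -/
def chainSlice (k : I → ℕ) : Set (Matrix (Σ i, Fin (k i)) (Σ i, Fin (k i)) ℝ) :=
  {M | ∀ i a (h : a + 1 < k i), M.col ⟨i, ⟨a + 1, h⟩⟩ = Pi.single ⟨i, ⟨a, by omega⟩⟩ 1}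

variable {N : Matrix (Σ i, Fin (k i)) (Σ i, Fin (k i)) ℝ}

/-- The contraction of `chainSlice k` to the nilpotent matrix in Jordan form. -/
def contract (N : Matrix (Σ i, Fin (k i)) (Σ i, Fin (k i)) ℝ) (t : ℝ)
    (M : Matrix (Σ i, Fin (k i)) (Σ i, Fin (k i)) ℝ) : Matrix (Σ i, Fin (k i)) (Σ i, Fin (k i)) ℝ :=
  N + Matrix.diagonal (fun s => t ^ ((s.2 : ℕ) + 1)) * (M - N)

theorem contract_sub_apply (t : ℝ) (M : Matrix (Σ i, Fin (k i)) (Σ i, Fin (k i)) ℝ) (x y) :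
    contract N t M x y - N x y = t ^ ((x.2 : ℕ) + 1) * (M x y - N x y) := by
  simp [contract]

theorem contract_one (M : Matrix (Σ i, Fin (k i)) (Σ i, Fin (k i)) ℝ) : contract N 1 M = M := by
  simp [contract]

theorem IsJordanChain.mem_chainSlice
    (hN : IsJordanChain (Matrix.toLin' N) fun s => Pi.single s 1) : N ∈ chainSlice k := by
  intro i a h
  have := hN.apply_succ i a h
  rwa [Matrix.toLin'_apply, Matrix.mulVec_single_one] at this

/-- With $D$ the diagonal matrix, this says that for $t\neq0$ the contraction is $tDMD^{-1}$. On
columns $a+1$ the powers of $t$ cancel, since the only entry is in row $a$; on columns $0$, where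
$N$ vanishes, row $a$ is multiplied by $t\cdot t^{a+1}/t$. -/
theorem contract_mul_diagonal (hN : IsJordanChain (Matrix.toLin' N) fun s => Pi.single s 1)
    {M : Matrix (Σ i, Fin (k i)) (Σ i, Fin (k i)) ℝ} (hM : M ∈ chainSlice k) (t : ℝ) :
    contract N t M * Matrix.diagonal (fun s => t ^ ((s.2 : ℕ) + 1)) =
      t • (Matrix.diagonal (fun s => t ^ ((s.2 : ℕ) + 1)) * M) := by
  ext x ⟨j, c, hc⟩
  have hx := contract_sub_apply (N := N) t M x ⟨j, c, hc⟩
  rw [Matrix.mul_diagonal, Matrix.smul_apply, Matrix.diagonal_mul, smul_eq_mul]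
  rcases c with _ | c
  · have h0 : N x ⟨j, 0, hc⟩ = 0 := by
      have := congrFun (hN.apply_zero j hc) x
      rwa [Matrix.toLin'_apply, Matrix.mulVec_single_one] at this
    rw [h0, sub_zero, sub_zero] at hx
    simp only [hx]
    ring
  · have h1 := congrFun (hN.mem_chainSlice j c hc) x
    have h2 := congrFun (hM j c hc) x
    rw [Matrix.col_apply] at h1 h2
    rw [h1, h2, sub_self, mul_zero, sub_eq_zero] at hx
    rw [hx, h2]
    by_cases hxc : x = ⟨j, c, by omega⟩
    · subst hxc; simp; ring
    · simp [hxc]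

theorem contract_mem_jordanClass (hN : IsJordanChain (Matrix.toLin' N) fun s => Pi.single s 1)
    {M : Matrix (Σ i, Fin (k i)) (Σ i, Fin (k i)) ℝ} (hM : M ∈ chainSlice k)
    (hMm : M ∈ jordanClass _ m) {t : ℝ} (ht : 0 < t) : contract N t M ∈ jordanClass _ m := by
  refine mem_jordanClass_of_mul_eq hMm ?_ ht.ne' (contract_mul_diagonal hN hM t)
  rw [Matrix.det_diagonal]
  exact (Finset.prod_pos fun s _ => pow_pos ht _).ne'

theorem contract_mem_entryBall {M : Matrix (Σ i, Fin (k i)) (Σ i, Fin (k i)) ℝ} {ε : ℝ}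
    (hM : M ∈ entryBall N ε) {t : ℝ} (ht : 0 ≤ t) (ht1 : t ≤ 1) :
    contract N t M ∈ entryBall N ε := fun x y => by
  rw [contract_sub_apply, abs_mul, abs_of_nonneg (pow_nonneg ht _)]
  exact (mul_le_of_le_one_left (abs_nonneg _) (pow_le_one₀ ht ht1)).trans_lt (hM x y)

/-- By the contraction, a path in the slice can be moved close to its centre. -/
theorem joinedIn_entryBall_of_chainSlice
    (hN : IsJordanChain (Matrix.toLin' N) fun s => Pi.single s 1)
    {A B : Matrix (Σ i, Fin (k i)) (Σ i, Fin (k i)) ℝ} {ε : ℝ} (hε : 0 < ε)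
    (hA : A ∈ entryBall N ε) (hB : B ∈ entryBall N ε)
    (hAB : JoinedIn (jordanClass _ m ∩ chainSlice k) A B) :
    JoinedIn (jordanClass _ m ∩ entryBall N ε) A B := by
  obtain ⟨hAm, hBm⟩ := hAB.mem
  obtain ⟨γ, hγ⟩ := hAB
  obtain ⟨K, hK⟩ : ∃ K, ∀ s x y, |γ s x y - N x y| ≤ K := by
    have hc : Continuous fun s => ∑ x, ∑ y, |γ s x y - N x y| :=
      continuous_finsetSum _ fun x _ => continuous_finsetSum _ fun y _ =>
        ((γ.continuous.matrix_elem x y).sub continuous_const).abs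
    obtain ⟨K, hK⟩ := (isCompact_range hc).bddAbove
    refine ⟨K, fun s x y => le_trans ?_ (hK ⟨s, rfl⟩)⟩
    exact (Finset.single_le_sum (f := fun y => |γ s x y - N x y|)
      (fun _ _ => abs_nonneg _) (Finset.mem_univ y)).trans
      (Finset.single_le_sum (f := fun x => ∑ y, |γ s x y - N x y|)
      (fun _ _ => Finset.sum_nonneg fun _ _ => abs_nonneg _) (Finset.mem_univ x))
  -- All exponents in the contraction are at least `1`, so for `t ≤ 1` every deviation from `N`
  -- shrinks by a factor of at most `t`.
  obtain ⟨t, ht0, ht1, htK⟩ : ∃ t : ℝ, 0 < t ∧ t ≤ 1 ∧ t * K < ε := by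
    have hlim : ∀ᶠ t : ℝ in 𝓝[>] 0, t * K < ε := by
      refine nhdsWithin_le_nhds (ContinuousAt.eventually_lt (by fun_prop) continuousAt_const ?_)
      simpa using hε
    obtain ⟨t, ht, ht'⟩ := (hlim.and (Ioc_mem_nhdsGT (zero_lt_one (α := ℝ)))).exists
    exact ⟨t, ht'.1, ht'.2, ht⟩
  have hcont : Continuous fun p : ℝ × Matrix (Σ i, Fin (k i)) (Σ i, Fin (k i)) ℝ =>
      contract N p.1 p.2 := by
    refine continuous_const.add (Continuous.matrix_mul (Continuous.matrix_diagonal ?_) ?_)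
    · fun_prop
    · fun_prop
  have hmove : ∀ M ∈ jordanClass _ m ∩ chainSlice k, M ∈ entryBall N ε →
      JoinedIn (jordanClass _ m ∩ entryBall N ε) M (contract N t M) := by
    intro M hM hMε
    -- The parameter runs from `1` down to `t` and stays positive; at `0` the contraction would
    -- reach `N` and could leave the class.
    refine JoinedIn.ofLine (f := fun s => contract N (1 - s * (1 - t)) M) ?_ ?_ ?_ ?_
    · have h1 : Continuous fun s : ℝ => (1 - s * (1 - t), M) := by fun_prop
      exact (hcont.comp h1).continuousOn
    · rw [zero_mul, sub_zero, contract_one]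
    · rw [one_mul, sub_sub_cancel]
    · rintro _ ⟨s, hs, rfl⟩
      have h0 : s * (1 - t) ≤ 1 * (1 - t) := mul_le_mul_of_nonneg_right hs.2 (by linarith)
      have h1 : 0 < 1 - s * (1 - t) := by linarith
      have h2 : 1 - s * (1 - t) ≤ 1 := by
        have := mul_nonneg hs.1 (sub_nonneg.2 ht1); linarith
      exact ⟨contract_mem_jordanClass hN hM.2 hM.1 h1, contract_mem_entryBall hMε h1.le h2⟩
  refine ((hmove A hAm hA).trans ?_).trans (hmove B hBm hB).symm
  have hct : Continuous (contract N t) := hcont.comp (Continuous.prodMk_right t)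
  refine ⟨γ.map hct, fun s => ⟨?_, fun x y => ?_⟩⟩
  · exact contract_mem_jordanClass hN (hγ s).2 (hγ s).1 ht0
  · show |contract N t (γ s) x y - N x y| < ε
    rw [contract_sub_apply, abs_mul, abs_of_nonneg (pow_nonneg ht0.le _)]
    refine lt_of_le_of_lt (mul_le_mul ?_ (hK s x y) (abs_nonneg _) ht0.le) htK
    rw [pow_succ]
    exact mul_le_of_le_one_left ht0.le (pow_le_one₀ ht0.le ht1)

/-- The matrices in `chainSlice k` in which the long Jordan chains of the slice continue to Jordan
chains of maximal length `h`. -/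
def genericSlice (k : I → ℕ) (hk0 : ∀ i, 0 < k i) (m : I' → ℕ) (h : ℕ)
    (σ : {i // 2 ≤ k i} ↪ {i // m i = h}) : Set (Matrix (Σ i, Fin (k i)) (Σ i, Fin (k i)) ℝ) :=
  {A | A ∈ jordanClass _ m ∩ chainSlice k ∧ ∃ v : {i // m i = h} → (Σ i, Fin (k i)) → ℝ,
    (LinearIndependent ℝ fun i => (Matrix.toLin' A ^ (h - 1)) (v i)) ∧
    ∀ i : {i // 2 ≤ k i}, v (σ i) = Pi.single ⟨i, ⟨k i - 1, Nat.sub_lt (hk0 i) one_pos⟩⟩ 1}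

theorem joinedIn_chainSlice [Fintype I'] {hk0 : ∀ i, 0 < k i} (hm0 : ∀ i, 0 < m i) {h : ℕ}
    (hm : ∀ i, m i ≤ h) (hh : 2 ≤ h) {z : I'} (hz : m z = 1)
    {σ : {i // 2 ≤ k i} ↪ {i // m i = h}} {A B : Matrix (Σ i, Fin (k i)) (Σ i, Fin (k i)) ℝ}
    (hA : A ∈ genericSlice k hk0 m h σ) (hB : B ∈ genericSlice k hk0 m h σ) :
    JoinedIn (jordanClass _ m ∩ chainSlice k) A B := by
  obtain ⟨⟨hA, hAs⟩, v, hv, hvσ⟩ := hA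
  obtain ⟨⟨hB, hBs⟩, w, hw, hwσ⟩ := hB
  obtain ⟨F, hF, hFAB, hFv⟩ := exists_det_pos_mul_eq_mul hA hB hm0 hm hh hz hv hw
  -- `F` fixes the generators of the long chains and intertwines `A` with `B`, which act alike along
  -- these chains. Hence it fixes the chains, by induction on the distance `j` from the generator.
  have hfix : ∀ (i : I) (hi : 2 ≤ k i) (j a : ℕ) (haj : a + j + 1 = k i),
      F.mulVec (Pi.single ⟨i, ⟨a, by omega⟩⟩ 1) = Pi.single ⟨i, ⟨a, by omega⟩⟩ 1 := by
    intro i hi j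
    induction j with
    | zero =>
      intro a haj
      have h1 := hFv (σ ⟨i, hi⟩)
      rw [hvσ, hwσ] at h1
      obtain rfl : a = k i - 1 := by omega
      exact h1
    | succ j ih =>
      intro a haj
      have h1 := ih (a + 1) (by omega)
      have h2 := hAs i a (by omega)
      have h3 := hBs i a (by omega)
      rw [← Matrix.mulVec_single_one] at h2 h3
      rw [← h2, Matrix.mulVec_mulVec, hFAB, ← Matrix.mulVec_mulVec, h1, h3, h2]
  obtain ⟨γ, hγ⟩ := joinedIn_posDet_fixing (fun s : Σ i, Fin (k i) => 2 ≤ k s.1) F hF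
    (fun ⟨i, a, ha⟩ hi => by
      rw [← Matrix.mulVec_single_one]
      exact hfix i hi (k i - 1 - a) a (by omega))
  have hu : ∀ t, IsUnit (γ t).det := fun t => isUnit_iff_ne_zero.2 (hγ t).1.ne'
  refine ⟨⟨⟨fun t => γ t * A * (γ t)⁻¹, ?_⟩, ?_, ?_⟩, fun t => ⟨?_, fun i a ha => ?_⟩⟩
  · have : Continuous fun t => (γ t)⁻¹ := continuous_iff_continuousAt.2 fun t =>
      (continuousAt_matrix_inv (hγ t).1.ne').comp γ.continuous.continuousAt
    exact (γ.continuous.matrix_mul continuous_const).matrix_mul this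
  · simp
  · show γ 1 * A * (γ 1)⁻¹ = B
    have := hu 1
    rw [γ.target] at this ⊢
    rw [hFAB, Matrix.mul_nonsing_inv_cancel_right _ _ this]
  · refine mem_jordanClass_of_mul_eq hA (hγ t).1.ne' one_ne_zero ?_
    show γ t * A * (γ t)⁻¹ * γ t = _
    rw [one_smul, Matrix.nonsing_inv_mul_cancel_right _ _ (hu t)]
  · show (γ t * A * (γ t)⁻¹).col ⟨i, ⟨a + 1, ha⟩⟩ = _
    have h1 := (hγ t).2 ⟨i, ⟨a + 1, ha⟩⟩ (by show 2 ≤ k i; omega)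
    have h2 := (hγ t).2 ⟨i, ⟨a, by omega⟩⟩ (by show 2 ≤ k i; omega)
    have h3 := hAs i a ha
    rw [← Matrix.mulVec_single_one] at h1 h2 h3 ⊢
    have h4 : (γ t)⁻¹.mulVec (Pi.single ⟨i, ⟨a + 1, ha⟩⟩ 1) = Pi.single ⟨i, ⟨a + 1, ha⟩⟩ 1 := by
      conv_lhs => rw [← h1]
      rw [Matrix.mulVec_mulVec, Matrix.nonsing_inv_mul _ (hu t), Matrix.one_mulVec]
    rw [← Matrix.mulVec_mulVec, h4, ← Matrix.mulVec_mulVec, h3, h2]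

/-- The matrix whose columns are the Jordan chains for `A` generated by the vectors `v i`. -/
def chainMatrix (A : Matrix (Σ i, Fin (k i)) (Σ i, Fin (k i)) ℝ)
    (v : I → (Σ i, Fin (k i)) → ℝ) : Matrix (Σ i, Fin (k i)) (Σ i, Fin (k i)) ℝ :=
  Matrix.of fun x s => (A ^ (k s.1 - 1 - s.2)).mulVec (v s.1) x

theorem continuous_chainMatrix : Continuous fun p : Matrix (Σ i, Fin (k i)) (Σ i, Fin (k i)) ℝ ×
    (I → (Σ i, Fin (k i)) → ℝ) => chainMatrix p.1 p.2 := by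
  refine continuous_matrix fun x s => ?_
  have h : Continuous fun p : Matrix (Σ i, Fin (k i)) (Σ i, Fin (k i)) ℝ ×
    (I → (Σ i, Fin (k i)) → ℝ) => (p.1 ^ (k s.1 - 1 - s.2)).mulVec (p.2 s.1) :=
    Continuous.matrix_mulVec (continuous_fst.pow _) (by fun_prop)
  exact (continuous_apply x).comp h

theorem chainMatrix_self (hk0 : ∀ i, 0 < k i)
    (hN : IsJordanChain (Matrix.toLin' N) fun s => Pi.single s 1) :
    chainMatrix N (fun i => Pi.single ⟨i, ⟨k i - 1, Nat.sub_lt (hk0 i) one_pos⟩⟩ 1) = 1 := by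
  ext x ⟨i, a, ha⟩
  have h1 := hN.pow_apply_add i a (k i - 1 - a) (by omega)
  rw [← Matrix.toLin'_pow, Matrix.toLin'_apply] at h1
  have h2 : (⟨i, ⟨a + (k i - 1 - a), by omega⟩⟩ : Σ i, Fin (k i)) =
      ⟨i, ⟨k i - 1, Nat.sub_lt (hk0 i) one_pos⟩⟩ := by
    congr 2; omega
  rw [h2] at h1
  simp only [chainMatrix, Matrix.of_apply]
  rw [h1, Matrix.one_apply, Pi.single_apply]

/-- In the basis of columns of `chainMatrix A v`, the matrix `A` sends each chain vector to the
next; only its values on the last ones are unconstrained. -/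
theorem inv_chainMatrix_conj_mem {A : Matrix (Σ i, Fin (k i)) (Σ i, Fin (k i)) ℝ}
    {v : I → (Σ i, Fin (k i)) → ℝ} (hG : IsUnit (chainMatrix A v).det) :
    (chainMatrix A v)⁻¹ * A * chainMatrix A v ∈ chainSlice k := by
  intro i a ha
  have hcol : ∀ s, (chainMatrix A v).mulVec (Pi.single s 1) =
      (A ^ (k s.1 - 1 - s.2)).mulVec (v s.1) :=
    fun s => by rw [Matrix.mulVec_single_one]; rfl
  rw [← Matrix.mulVec_single_one, ← Matrix.mulVec_mulVec, hcol, Matrix.mulVec_mulVec, mul_assoc,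
    ← pow_succ']
  have : k i - 1 - (a + 1) + 1 = k i - 1 - a := by omega
  have h2 := hcol ⟨i, ⟨a, by omega⟩⟩
  simp only at h2 ⊢
  rw [this, ← Matrix.mulVec_mulVec, ← h2, Matrix.mulVec_mulVec, Matrix.nonsing_inv_mul _ hG,
    Matrix.one_mulVec]

end Slice

/-! ### Moving nearby matrices into the slice -/

section Slice

variable {I I' : Type*} [Fintype I] [DecidableEq I] {k : I → ℕ} {m : I' → ℕ}
  {N : Matrix (Σ i, Fin (k i)) (Σ i, Fin (k i)) ℝ}

theorem exists_nhds_joinedIn_genericSlice [Finite I'] (hk0 : ∀ i, 0 < k i)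
    (hN : IsJordanChain (Matrix.toLin' N) fun s => Pi.single s 1) {h : ℕ} (hh : 0 < h)
    (σ : {i // 2 ≤ k i} ↪ {i // m i = h}) {ε : ℝ} (hε : 0 < ε) :
    ∃ W ∈ 𝓝 N, ∀ A ∈ jordanClass _ m ∩ W, ∃ A' ∈ genericSlice k hk0 m h σ,
      JoinedIn (jordanClass _ m ∩ entryBall N ε) A A' := by
  classical
  have hdet : ∀ᶠ G in 𝓝 (1 : Matrix (Σ i, Fin (k i)) (Σ i, Fin (k i)) ℝ), G.det ≠ 0 := by
    have hc : Continuous fun G : Matrix (Σ i, Fin (k i)) (Σ i, Fin (k i)) ℝ => G.det :=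
      continuous_id.matrix_det
    exact hc.continuousAt.eventually_ne (by simp)
  have hconj : ∀ᶠ p in 𝓝 (N, (1 : Matrix (Σ i, Fin (k i)) (Σ i, Fin (k i)) ℝ)),
      p.2⁻¹ * p.1 * p.2 ∈ entryBall N ε := by
    have hc : ContinuousAt (fun p : Matrix (Σ i, Fin (k i)) (Σ i, Fin (k i)) ℝ ×
        Matrix (Σ i, Fin (k i)) (Σ i, Fin (k i)) ℝ => p.2⁻¹ * p.1 * p.2) (N, 1) := by
      have h1 : ContinuousAt (fun p : Matrix (Σ i, Fin (k i)) (Σ i, Fin (k i)) ℝ ×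
          Matrix (Σ i, Fin (k i)) (Σ i, Fin (k i)) ℝ => p.2⁻¹) (N, 1) :=
        ContinuousAt.comp (f := Prod.snd) (continuousAt_matrix_inv (by simp)) continuousAt_snd
      exact (h1.mul continuousAt_fst).mul continuousAt_snd
    refine hc ?_
    simpa using entryBall_mem_nhds N hε
  rw [nhds_prod_eq] at hconj
  obtain ⟨W₁, hW₁, U, hU, hWU⟩ := eventually_prod_iff.1 hconj
  obtain ⟨r, hr, hball⟩ := exists_entryBall_subset (hdet.and hU)
  set e : I → (Σ i, Fin (k i)) → ℝ :=
    fun i => Pi.single ⟨i, ⟨k i - 1, Nat.sub_lt (hk0 i) one_pos⟩⟩ 1 with he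
  have hchain : ∀ᶠ p in 𝓝 N ×ˢ 𝓝 e, chainMatrix p.1 p.2 ∈ entryBall 1 r := by
    rw [← nhds_prod_eq]
    refine continuous_chainMatrix.continuousAt ?_
    simp only [he, chainMatrix_self hk0 hN]
    exact entryBall_mem_nhds _ hr
  obtain ⟨W₂, hW₂, V, hV, hWV⟩ := eventually_prod_iff.1 hchain
  refine ⟨{A | W₁ A ∧ W₂ A}, hW₁.and hW₂, fun A ⟨hA, hA₁, hA₂⟩ => ?_⟩
  -- Longest chains of the class not assigned to a chain of `N` start from the value `0`; the
  -- generic perturbation makes up for it.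
  set w : {i // m i = h} → (Σ i, Fin (k i)) → ℝ := Function.extend σ (fun i => e i) 0 with hw
  obtain ⟨b, hb⟩ := id hA
  obtain ⟨g, hg⟩ := hb.eventually_linearIndependent hh w
  -- Chains of length one need no perturbation, as the slice does not constrain their columns. At `s
  -- = 0` this is `e`, whose chain matrix for `N` is `1`.
  let u : ℝ → I → (Σ i, Fin (k i)) → ℝ :=
    fun s i => if hi : 2 ≤ k i then w (σ ⟨i, hi⟩) + s • g (σ ⟨i, hi⟩) else e i
  have hu : ∀ᶠ s in 𝓝[≠] (0 : ℝ), V (u s) := by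
    have hc : Continuous u := by
      refine continuous_pi fun i => ?_
      by_cases hi : 2 ≤ k i
      · simp only [u, dif_pos hi]; fun_prop
      · simp only [u, dif_neg hi]; fun_prop
    have h0 : u 0 = e := by
      funext i
      by_cases hi : 2 ≤ k i
      · simp [u, dif_pos hi, hw, σ.injective.extend_apply]
      · simp only [u, dif_neg hi]
    refine nhdsWithin_le_nhds (hc.continuousAt ?_)
    rw [h0]
    exact hV
  obtain ⟨s, hgs, hus⟩ := (hg.and hu).exists
  set G := chainMatrix A (u s) with hG
  have hGr : G ∈ entryBall 1 r := hWV hA₂ hus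
  have hGu : ∀ G' ∈ entryBall 1 r, IsUnit (G' : Matrix (Σ i, Fin (k i)) (Σ i, Fin (k i)) ℝ).det :=
    fun G' h' => isUnit_iff_ne_zero.2 (hball h').1
  have hmem : ∀ G' ∈ entryBall 1 r, G'⁻¹ * A * G' ∈ jordanClass _ m ∩ entryBall N ε := by
    intro G' h'
    refine ⟨mem_jordanClass_of_mul_eq (F := G'⁻¹) hA ?_ one_ne_zero ?_, hWU hA₁ (hball h').2⟩
    · exact (Matrix.isUnit_nonsing_inv_det _ (hGu G' h')).ne_zero
    · rw [one_smul, Matrix.mul_nonsing_inv_cancel_right _ _ (hGu G' h')]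
  have hinv : ∀ v, G⁻¹.mulVec (G.mulVec v) = v := fun v => by
    rw [Matrix.mulVec_mulVec, Matrix.nonsing_inv_mul _ (hGu G hGr), Matrix.one_mulVec]
  refine ⟨G⁻¹ * A * G, ⟨⟨(hmem G hGr).1, inv_chainMatrix_conj_mem (hGu G hGr)⟩,
    fun i => G⁻¹.mulVec (w i + s • g i), ?_, fun i => ?_⟩, ?_⟩
  · have hpow : ∀ (j : ℕ) v, (Matrix.toLin' (G⁻¹ * A * G) ^ j) (G⁻¹.mulVec v) =
        Matrix.toLin' G⁻¹ ((Matrix.toLin' A ^ j) v) := by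
      intro j v
      induction j with
      | zero => simp
      | succ j ih =>
        rw [pow_succ', End.mul_apply, ih, pow_succ', End.mul_apply]
        simp only [Matrix.toLin'_apply, Matrix.mulVec_mulVec]
        rw [mul_assoc _ G, Matrix.mul_nonsing_inv _ (hGu G hGr), mul_one]
    simp only [hpow]
    refine hgs.map' (Matrix.toLin' G⁻¹) (LinearMap.ker_eq_bot.2 fun x y hxy => ?_)
    have := congrArg G.mulVec hxy
    simpa [Matrix.toLin'_apply, Matrix.mulVec_mulVec, Matrix.mul_nonsing_inv _ (hGu G hGr)]
      using this
  · have h1 : G.mulVec (Pi.single ⟨i, ⟨k i - 1, Nat.sub_lt (hk0 i) one_pos⟩⟩ 1) =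
        w (σ i) + s • g (σ i) := by
      rw [Matrix.mulVec_single_one]
      ext x
      simp [hG, chainMatrix, u, i.2]
    show G⁻¹.mulVec (w (σ i) + s • g (σ i)) = _
    rw [← h1, hinv]
  -- The ball about `1` is convex and consists of invertible matrices, so conjugation along the
  -- segment from `1` to `G` is defined and stays near `N`.
  · refine JoinedIn.ofLine (f := fun t => (1 + t • (G - 1))⁻¹ * A * (1 + t • (G - 1))) ?_ ?_ ?_ ?_
    · intro t ht
      have h2 : ContinuousAt (fun t : ℝ => 1 + t • (G - 1)) t := by fun_prop
      have h1 := ContinuousAt.comp (f := fun t : ℝ => 1 + t • (G - 1)) (continuousAt_matrix_inv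
        (hGu _ (lineMap_mem_entryBall hGr ht.1 ht.2)).ne_zero) h2
      exact ContinuousAt.continuousWithinAt (.mul (.mul h1 continuousAt_const) h2)
    · simp
    · simp
    · rintro _ ⟨t, ht, rfl⟩
      exact hmem _ (lineMap_mem_entryBall hGr ht.1 ht.2)

theorem exists_nhds_joinedIn [Finite I'] (hk0 : ∀ i, 0 < k i) (hm0 : ∀ i, 0 < m i)
    (hN : IsJordanChain (Matrix.toLin' N) fun s => Pi.single s 1) {h : ℕ} (hm : ∀ i, m i ≤ h)
    (hh : 2 ≤ h) {z : I'} (hz : m z = 1) (σ : {i // 2 ≤ k i} ↪ {i // m i = h}) {ε : ℝ}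
    (hε : 0 < ε) : ∃ W ∈ 𝓝 N, ∀ A ∈ jordanClass _ m ∩ W, ∀ B ∈ jordanClass _ m ∩ W,
      JoinedIn (jordanClass _ m ∩ entryBall N ε) A B := by
  have := Fintype.ofFinite I'
  obtain ⟨W, hW, H⟩ := exists_nhds_joinedIn_genericSlice hk0 hN (by omega) σ hε
  refine ⟨W, hW, fun A hA B hB => ?_⟩
  obtain ⟨A', hA', hAA'⟩ := H A hA
  obtain ⟨B', hB', hBB'⟩ := H B hB
  exact (hAA'.trans (joinedIn_entryBall_of_chainSlice hN hε
    hAA'.target_mem.2 hBB'.target_mem.2 (joinedIn_chainSlice hm0 hm hh hz hA' hB'))).trans hBB'.symm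

end Slice

/-! ### Existence of the Jordan form -/

section Existence

open Polynomial in
/-- A nilpotent endomorphism of a finite-dimensional real vector space has a basis of Jordan
chains. -/
theorem exists_isJordanChain {V : Type*} [AddCommGroup V] [Module ℝ V] [FiniteDimensional ℝ V]
    {T : End ℝ V} (hT : IsNilpotent T) : ∃ (r : ℕ) (k : Fin r → ℕ)
      (b : Basis (Σ i, Fin (k i)) ℝ V), (∀ i, 0 < k i) ∧ IsJordanChain T b := by
  classical
  obtain ⟨p, hp⟩ := hT
  have htors : Module.IsTorsion' (AEval' T) (Submonoid.powers (X : ℝ[X])) := by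
    intro v
    refine ⟨⟨X ^ p, p, rfl⟩, ?_⟩
    obtain ⟨v, rfl⟩ := (AEval'.of T).surjective v
    show (X ^ p : ℝ[X]) • AEval'.of T v = 0
    rw [AEval'.X_pow_smul_of, hp]
    simp
  -- With `X` acting as `T`, the space is a torsion module over a principal ideal domain, hence a
  -- sum of quotients by powers of `X`. The powers of `X` in each quotient form a chain; exponents
  -- `k i = 0` give zero summands and are dropped below.
  obtain ⟨d, k, ⟨e⟩⟩ := Module.torsion_by_prime_power_decomposition
    (Polynomial.irreducible_X (R := ℝ)) htors
  let F : V ≃ₗ[ℝ] _ := (AEval'.of T).trans (e.restrictScalars ℝ)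
  let l : ∀ i, ℝ[X] →ₗ[ℝ[X]] _ := fun i =>
    (DirectSum.lof ℝ[X] (Fin d) (fun i => ℝ[X] ⧸ ℝ[X] ∙ (X : ℝ[X]) ^ k i) i) ∘ₗ Submodule.mkQ _
  have hFT : ∀ v, F (T v) = (X : ℝ[X]) • F v := fun v => by
    show e (AEval'.of T (T v)) = (X : ℝ[X]) • e (AEval'.of T v)
    rw [← map_smul, AEval'.X_smul_of]
  have hC : ∀ (c : ℝ) i q, l i ((C c : ℝ[X]) • q) = c • l i q := fun c i q => by
    rw [map_smul]
    exact algebraMap_smul ℝ[X] c (l i q)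
  have hl0 : ∀ i j, k i ≤ j → l i (X ^ j) = 0 := fun i j hj => by
    have : Submodule.Quotient.mk (p := ℝ[X] ∙ (X : ℝ[X]) ^ k i) (X ^ j) = 0 := by
      rw [Submodule.Quotient.mk_eq_zero]
      exact Ideal.mem_span_singleton.2 (pow_dvd_pow _ hj)
    rw [LinearMap.comp_apply, Submodule.mkQ_apply, this, map_zero]
  have hT' : ∀ i j, T (F.symm (l i (X ^ j))) = F.symm (l i (X ^ (j + 1))) := fun i j => by
    apply F.injective
    rw [hFT, F.apply_symm_apply, F.apply_symm_apply, ← map_smul, smul_eq_mul, pow_succ']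
  let x : (Σ i : {i // 0 < k i}, Fin (k i)) → V := fun s => F.symm (l s.1 (X ^ (k s.1 - 1 - s.2)))
  have hx : IsJordanChain (k := fun i : {i // 0 < k i} => k i) T x := by
    constructor
    · intro i hi
      show T (F.symm (l i (X ^ (k i - 1 - 0)))) = 0
      rw [hT', hl0 _ _ (by omega), map_zero]
    · intro i a hi
      show T (F.symm (l i (X ^ (k i - 1 - (a + 1))))) = F.symm (l i (X ^ (k i - 1 - a)))
      rw [hT', show k i - 1 - (a + 1) + 1 = k i - 1 - a by omega]
  have hli : LinearIndependent ℝ x := by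
    refine hx.linearIndependent (fun i => i.2) ?_
    rw [Fintype.linearIndependent_iff]
    intro c hc i
    have h1 := congrArg F hc
    rw [map_zero, map_sum] at h1
    have h2 : ∑ j : {i // 0 < k i}, l j (C (c j) * X ^ (k j - 1)) = 0 := by
      rw [← h1]
      refine Finset.sum_congr rfl fun j _ => ?_
      rw [map_smul, F.apply_symm_apply, ← smul_eq_mul, hC]
      rfl
    have h3 := congrArg (DirectSum.component ℝ[X] (Fin d) _ i) h2
    rw [map_sum, map_zero, Finset.sum_eq_single i] at h3
    · simp only [l, LinearMap.comp_apply, DirectSum.component.lof_self, Submodule.mkQ_apply] at h3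
      rw [Submodule.Quotient.mk_eq_zero] at h3
      have h4 := Polynomial.X_pow_dvd_iff.1 (Ideal.mem_span_singleton.1 h3) (k i - 1) (by have := i.2; omega)
      simpa using h4
    · intro j _ hj
      simp only [l, LinearMap.comp_apply]
      rw [DirectSum.component.of, dif_neg fun h => hj (Subtype.ext h)]
    · simp
  have hspan : ⊤ ≤ Submodule.span ℝ (Set.range x) := by
    have hX : ∀ i j, F.symm (l i (X ^ j)) ∈ Submodule.span ℝ (Set.range x) := fun i j => by
      rcases le_or_gt (k i) j with hj | hj
      · rw [hl0 i j hj, map_zero]; exact zero_mem _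
      · refine Submodule.subset_span ⟨⟨⟨i, by omega⟩, ⟨k i - 1 - j, by simp; omega⟩⟩, ?_⟩
        show F.symm (l i (X ^ (k i - 1 - (k i - 1 - j)))) = _
        rw [show k i - 1 - (k i - 1 - j) = j by omega]
    have hl : ∀ i q, F.symm (l i q) ∈ Submodule.span ℝ (Set.range x) := fun i q => by
      induction q using Polynomial.induction_on' with
      | add q q' h h' => rw [map_add, map_add]; exact add_mem h h'
      | monomial j c =>
        rw [← C_mul_X_pow_eq_monomial, ← smul_eq_mul, hC, map_smul]
        exact Submodule.smul_mem _ _ (hX i j)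
    intro v _
    rw [← F.symm_apply_apply v]
    induction F v using DirectSum.induction_on with
    | zero => rw [map_zero]; exact zero_mem _
    | of i y =>
      obtain ⟨q, rfl⟩ := Submodule.mkQ_surjective _ y
      exact hl i q
    | add y z hy hz => rw [map_add]; exact add_mem hy hz
  let τ := Fintype.equivFin {i // 0 < k i}
  let b := (Basis.mk hli hspan).reindex
    (Equiv.sigmaCongrLeft (β := fun i : {i // 0 < k i} => Fin (k i)) τ.symm).symm
  have hb : ∀ i a, b ⟨i, a⟩ = x ⟨τ.symm i, a⟩ := fun i a => by
    simp [b]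
  refine ⟨_, fun i => k (τ.symm i), b, fun i => (τ.symm i).2, fun i hi => ?_, fun i a hi => ?_⟩
  · rw [hb]; exact hx.apply_zero _ _
  · rw [hb, hb]; exact hx.apply_succ _ _ _

end Existence

/-! ### Conjugacy classes and block sizes -/

section Conjugacy

variable {ι : Type*} [Fintype ι] [DecidableEq ι] {I : Type*} {m : I → ℕ}

theorem isConj_of_mem_jordanClass {A B : Matrix ι ι ℝ} (hA : A ∈ jordanClass ι m)
    (hB : B ∈ jordanClass ι m) : IsConj A B := by
  obtain ⟨b₁, hb₁⟩ := hA
  obtain ⟨b₂, hb₂⟩ := hB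
  let f : (ι → ℝ) ≃ₗ[ℝ] (ι → ℝ) := b₁.equiv b₂ (Equiv.refl _)
  have hf : ∀ s, f (b₁ s) = b₂ s := fun s => by simp [f]
  have hc := hb₁.comp_eq hb₂ (f : (ι → ℝ) →ₗ[ℝ] (ι → ℝ)) hf
  have hu : IsUnit (LinearMap.toMatrix' (f : (ι → ℝ) →ₗ[ℝ] (ι → ℝ))) := by
    rw [Matrix.isUnit_iff_isUnit_det, LinearMap.det_toMatrix']
    exact f.isUnit_det'
  refine ⟨hu.unit, ?_⟩
  show LinearMap.toMatrix' _ * A = B * LinearMap.toMatrix' _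
  apply Matrix.toLin'.injective
  rw [Matrix.toLin'_mul, Matrix.toLin'_mul, Matrix.toLin'_toMatrix', hc]

theorem mem_jordanClass_of_isConj {A B : Matrix ι ι ℝ} (hA : A ∈ jordanClass ι m)
    (h : IsConj A B) : B ∈ jordanClass ι m := by
  obtain ⟨c, hc⟩ := h
  refine mem_jordanClass_of_mul_eq (F := c) hA ?_ one_ne_zero ?_
  · exact ((Matrix.isUnit_iff_isUnit_det _).1 c.isUnit).ne_zero
  · rw [one_smul]; exact hc.symm

theorem carrier_eq_jordanClass {n : ℕ} {C : ConjClasses (Mat n)} {A : Mat n} (hAC : A ∈ C.carrier)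
    (hA : A ∈ jordanClass (Fin n) m) : C.carrier = jordanClass (Fin n) m := by
  rw [ConjClasses.mem_carrier_iff_mk_eq] at hAC
  subst hAC
  ext B
  rw [ConjClasses.mem_carrier_iff_mk_eq, ConjClasses.mk_eq_mk_iff_isConj]
  exact ⟨fun h => mem_jordanClass_of_isConj hA h.symm, fun h => isConj_of_mem_jordanClass h hA⟩

theorem jordanMatrix_mem_jordanClass {n : ℕ} (c : Composition n) :
    jordanMatrix c ∈ jordanClass (Fin n) c.blocksFun := by
  let b := (Pi.basisFun ℝ (Fin n)).reindex c.blocksFinEquiv.symm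
  have hb : ∀ s, b s = Pi.single (c.blocksFinEquiv s) 1 := fun s => by simp [b]
  have hJ : ∀ s t, (Matrix.toLin' (jordanMatrix c) (b t)) (c.blocksFinEquiv s) =
      Matrix.blockDiagonal' (fun i : Fin c.length => jordanBlock (c.blocksFun i)) s t :=
    fun s t => by
      rw [hb, Matrix.toLin'_apply, Matrix.mulVec_single_one]
      simp [jordanMatrix]
  refine ⟨b, fun i hi => ?_, fun i a ha => ?_⟩
  · ext x
    obtain ⟨⟨j, e⟩, rfl⟩ := c.blocksFinEquiv.surjective x
    rw [hJ]
    by_cases h : j = i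
    · subst h; rw [Matrix.blockDiagonal'_apply_eq]; simp [jordanBlock]
    · rw [Matrix.blockDiagonal'_apply_ne _ _ _ h]; rfl
  · ext x
    obtain ⟨⟨j, e⟩, rfl⟩ := c.blocksFinEquiv.surjective x
    rw [hJ, hb, Pi.single_apply]
    simp only [c.blocksFinEquiv.injective.eq_iff]
    by_cases h : j = i
    · subst h
      rw [Matrix.blockDiagonal'_apply_eq]
      simp [jordanBlock, Fin.ext_iff, eq_comm]
    · rw [Matrix.blockDiagonal'_apply_ne _ _ _ h, if_neg fun h' => h (congrArg Sigma.fst h')]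

theorem jordanClass_reindex {I' : Type*} {m' : I' → ℕ} (τ : I' ≃ I) (h : ∀ i, m (τ i) = m' i)
    {A : Matrix ι ι ℝ} (hA : A ∈ jordanClass ι m) : A ∈ jordanClass ι m' := by
  obtain rfl : (fun i => m (τ i)) = m' := funext h
  obtain ⟨b, hb⟩ := hA
  let b' := b.reindex (Equiv.sigmaCongrLeft (β := fun i => Fin (m i)) τ).symm
  have hb' : ∀ i a, b' ⟨i, a⟩ = b ⟨τ i, a⟩ := fun i a => by simp [b']
  refine ⟨b', fun i hi => ?_, fun i a hi => ?_⟩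
  · rw [hb']; exact hb.apply_zero _ _
  · rw [hb', hb']; exact hb.apply_succ _ _ _

theorem exists_mem_jordanClass_blocksFun {n : ℕ} {M : Mat n} (hM : IsNilpotent M) :
    ∃ c : Composition n, M ∈ jordanClass (Fin n) c.blocksFun := by
  have hT : IsNilpotent (Matrix.toLin' M) := by
    obtain ⟨p, hp⟩ := hM
    exact ⟨p, by rw [← Matrix.toLin'_pow, hp, map_zero]⟩
  obtain ⟨r, k, b, hk, hb⟩ := exists_isJordanChain hT
  have hsum : ∑ i, k i = n := by
    have := finrank_eq_card_basis b
    simpa using this.symm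
  let c : Composition n := ⟨List.ofFn k, by
    intro i hi
    obtain ⟨j, rfl⟩ := (List.mem_ofFn' _ _).1 hi
    exact hk j, by rw [List.sum_ofFn, hsum]⟩
  have hlen : c.length = r := List.length_ofFn
  refine ⟨c, jordanClass_reindex (finCongr hlen) (fun i => ?_) ⟨b, hb⟩⟩
  show _ = (List.ofFn k).get i
  rw [List.get_ofFn]
  rfl

theorem exists_carrier_eq_jordanClass {n : ℕ} {C : ConjClasses (Mat n)}
    (hC : ∀ M ∈ C.carrier, IsNilpotent M) :
    C.carrier = jordanClass (Fin n) (jordanSizes C).blocksFun := by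
  have hex : ∃ c : Composition n, jordanMatrix c ∈ C.carrier := by
    obtain ⟨M, rfl⟩ := C.exists_rep
    obtain ⟨c, hc⟩ := exists_mem_jordanClass_blocksFun (hC M ConjClasses.mem_carrier_mk)
    refine ⟨c, ?_⟩
    rw [carrier_eq_jordanClass ConjClasses.mem_carrier_mk hc]
    exact jordanMatrix_mem_jordanClass c
  exact carrier_eq_jordanClass (Classical.epsilon_spec hex) (jordanMatrix_mem_jordanClass _)

end Conjugacy

/-! ### Counting blocks -/

section Invariants

theorem le_foldr_max {l : List ℕ} {a : ℕ} (h : a ∈ l) : a ≤ l.foldr max 0 := by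
  induction l with
  | nil => simp at h
  | cons b l ih =>
    rw [List.foldr_cons]
    rcases List.mem_cons.1 h with rfl | h
    · exact le_max_left _ _
    · exact (ih h).trans (le_max_right _ _)

theorem card_subtype_blocksFun {n : ℕ} (c : Composition n) (p : ℕ → Prop) [DecidablePred p] :
    Fintype.card {i // p (c.blocksFun i)} = c.blocks.countP (fun a => p a) := by
  rw [← c.ofFn_blocksFun, List.ofFn_eq_map, List.countP_map, Fintype.card_subtype,
    List.countP_eq_length_filter, ← List.toFinset_card_of_nodup ((List.nodup_finRange _).filter _)]
  congr 1
  ext i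
  simp

end Invariants

/-! ### Change of coordinates and the theorem -/

section Transfer

variable {ι κ : Type*} [Fintype ι] [DecidableEq ι] [Fintype κ] [DecidableEq κ] {I : Type*}
  {m : I → ℕ}

/-- A change of coordinates preserves the classes given by the Jordan form. -/
theorem toMatrix_mem_jordanClass (e : (ι → ℝ) ≃ₗ[ℝ] (κ → ℝ)) {A : Matrix ι ι ℝ}
    {B : Matrix κ κ ℝ} (hAB : ∀ v, Matrix.toLin' B (e v) = e (Matrix.toLin' A v))
    (hA : A ∈ jordanClass ι m) : B ∈ jordanClass κ m := by
  obtain ⟨b, hb⟩ := hA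
  refine ⟨b.map e, fun i hi => ?_, fun i a hi => ?_⟩
  · rw [Basis.map_apply, hAB, hb.apply_zero, map_zero]
  · rw [Basis.map_apply, Basis.map_apply, hAB, hb.apply_succ]

end Transfer

end NilpotentClass

open NilpotentClass in
theorem NilpotentClass.locallyConnectedAt_of_one_lt {n : ℕ} {N : Mat n} (hN : IsNilpotent N)
    {C : ConjClasses (Mat n)} (hC : ∀ M ∈ C.carrier, IsNilpotent M) (hzero : HasZeroBlock C)
    (hheight : 2 ≤ height C) (hbeta : beta (ConjClasses.mk N) ≤ betaTop C) :
    LocallyConnectedAt C N := by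
  classical
  have hNN : ∀ M ∈ (ConjClasses.mk N).carrier, IsNilpotent M := by
    intro M hM
    rw [ConjClasses.mem_carrier_iff_mk_eq, ConjClasses.mk_eq_mk_iff_isConj] at hM
    obtain ⟨c, hc⟩ := hM.symm
    obtain ⟨p, hp⟩ := hN
    refine ⟨p, ?_⟩
    have h1 : (c : Mat n) * N ^ p = M ^ p * c := hc.pow_right p
    rw [hp, mul_zero] at h1
    exact (c.isUnit.mul_left_eq_zero).1 h1.symm
  have hNJ : N ∈ jordanClass (Fin n) (jordanSizes (ConjClasses.mk N)).blocksFun := by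
    rw [← exists_carrier_eq_jordanClass hNN]
    exact ConjClasses.mem_carrier_mk
  have hCJ := exists_carrier_eq_jordanClass hC
  set k := (jordanSizes (ConjClasses.mk N)).blocksFun with hk
  set m := (jordanSizes C).blocksFun with hm
  obtain ⟨σ⟩ : Nonempty ({i // 2 ≤ k i} ↪ {i // m i = height C}) := by
    refine Function.Embedding.nonempty_of_card_le ?_
    rw [hk, hm, card_subtype_blocksFun _ (fun a => 2 ≤ a),
      card_subtype_blocksFun _ (fun a => a = height C)]
    refine hbeta.trans_eq ?_
    rw [betaTop, List.count]
    congr 1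
  obtain ⟨z, hz⟩ : ∃ z, m z = 1 := by
    rw [HasZeroBlock, ← Composition.ofFn_blocksFun] at hzero
    exact (List.mem_ofFn' _ _).1 hzero
  have hmle : ∀ i, m i ≤ height C := fun i => le_foldr_max (Composition.blocksFun_mem_blocks _ i)
  obtain ⟨b, hb⟩ := hNJ
  -- Coordinates in a Jordan basis of `N`. They do not preserve entrywise balls, but are linear
  -- homeomorphisms, so small balls can be compared.
  let Φ : Mat n ≃ₗ[ℝ] Matrix (Σ i, Fin (k i)) (Σ i, Fin (k i)) ℝ :=
    Matrix.toLin'.trans (LinearMap.toMatrix b b)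
  have hΦ : ∀ M v, Matrix.toLin' (Φ M) (b.equivFun v) = b.equivFun (Matrix.toLin' M v) := by
    intro M v
    rw [Matrix.toLin'_apply]
    exact LinearMap.toMatrix_mulVec_repr b b _ v
  have hΦN : IsJordanChain (Matrix.toLin' (Φ N)) fun s => Pi.single s 1 := by
    have hbs : ∀ s, (Pi.single s 1 : (Σ i, Fin (k i)) → ℝ) = b.equivFun (b s) := fun s => by
      ext t
      simp [Pi.single_apply, eq_comm]
    refine ⟨fun i hi => ?_, fun i a hi => ?_⟩
    · rw [hbs, hΦ, hb.apply_zero, map_zero]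
    · rw [hbs, hΦ, hb.apply_succ, hbs]
  have hΦc : Continuous Φ := Φ.toLinearMap.continuous_of_finiteDimensional
  have hΦc' : Continuous Φ.symm := Φ.symm.toLinearMap.continuous_of_finiteDimensional
  have hmem : ∀ M, M ∈ C.carrier → Φ M ∈ jordanClass _ m := fun M hM =>
    toMatrix_mem_jordanClass b.equivFun (hΦ M) (hCJ ▸ hM)
  have hmem' : ∀ M, M ∈ jordanClass _ m → Φ.symm M ∈ C.carrier := fun M hM => by
    rw [hCJ]
    refine toMatrix_mem_jordanClass b.equivFun.symm (fun v => ?_) hM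
    apply b.equivFun.injective
    rw [← hΦ, LinearEquiv.apply_symm_apply, LinearEquiv.apply_symm_apply,
      LinearEquiv.apply_symm_apply]
  intro ε hε
  have hball : Φ.symm ⁻¹' (entryBall N ε) ∈ 𝓝 (Φ N) := by
    refine hΦc'.continuousAt ?_
    rw [LinearEquiv.symm_apply_apply]
    exact entryBall_mem_nhds N hε
  obtain ⟨η, hη, hηε⟩ := exists_entryBall_subset hball
  obtain ⟨W, hW, H⟩ := exists_nhds_joinedIn (m := m)
    (fun i => Composition.one_le_blocksFun _ i) (fun i => Composition.one_le_blocksFun _ i) hΦN hmle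
    hheight hz σ hη
  obtain ⟨δ, hδ, hδW⟩ := exists_entryBall_subset (hΦc.continuousAt hW)
  refine ⟨δ, hδ, fun A hA B hB => ?_⟩
  have hj := (H (Φ A) ⟨hmem A hA.1, hδW hA.2⟩ (Φ B) ⟨hmem B hB.1, hδW hB.2⟩).map hΦc'
  rw [LinearEquiv.symm_apply_apply, LinearEquiv.symm_apply_apply] at hj
  refine hj.mono ?_
  rintro _ ⟨M, hM, rfl⟩
  exact ⟨hmem' M hM.1, hηε hM.2⟩

open NilpotentClass in
-- With no block larger than `1`, the class consists of the zero matrix alone.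
theorem NilpotentClass.locallyConnectedAt_of_height_le_one {n : ℕ} (N : Mat n)
    {C : ConjClasses (Mat n)} (hC : ∀ M ∈ C.carrier, IsNilpotent M) (hheight : height C ≤ 1) :
    LocallyConnectedAt C N := by
  have h0 : ∀ M ∈ C.carrier, M = 0 := by
    intro M hM
    rw [exists_carrier_eq_jordanClass hC] at hM
    obtain ⟨b, hb⟩ := hM
    have := hb.pow_eq_zero (h := 1) fun i =>
      (le_foldr_max (Composition.blocksFun_mem_blocks _ i)).trans hheight
    rw [pow_one] at this
    exact Matrix.toLin'.injective (this.trans (map_zero _).symm)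
  refine fun ε hε => ⟨ε, hε, fun A hA B hB => ?_⟩
  rw [h0 A hA.1, ← h0 B hB.1]
  exact JoinedIn.refl hB

/-- Every nilpotent class `C` whose Jordan form has a zero block and at least as many longest blocks
as `N` has nonzero blocks is locally connected at `N`. If the height of `C` is smaller than that of
`N`, then `C` has no points near `N`, so that the proof does not refer to `hheight`. -/
theorem mainTheorem9 (n : ℕ) (N : NilpotentClass.Mat n) (hN : IsNilpotent N)
    (C : ConjClasses (NilpotentClass.Mat n)) (hC : ∀ M ∈ C.carrier, IsNilpotent M)
    (hzero : NilpotentClass.HasZeroBlock C)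
    (hheight : NilpotentClass.height (ConjClasses.mk N) ≤ NilpotentClass.height C)
    (hbeta : NilpotentClass.beta (ConjClasses.mk N) ≤ NilpotentClass.betaTop C) :
    NilpotentClass.LocallyConnectedAt C N := by
  rcases le_or_gt (NilpotentClass.height C) 1 with h | h
  · exact NilpotentClass.locallyConnectedAt_of_height_le_one N hC h
  · exact NilpotentClass.locallyConnectedAt_of_one_lt hN hC hzero h hbeta
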